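/- Let $n\ge 5$ and let $s\ne t$ be integers in $\{1,2,\dots,\lfloor n/2\rfloor\}$. Let $C_n(s,t)$ be the circulant graph whose vertices are the residues modulo $n$, two vertices $x,y$ being adjacent if and only if $x-y\equiv \pm s$ or $x-y\equiv\pm t \pmod n$. Let $\mathcal N(C_n(s,t))$ be its neighborhood complex, the simplicial complex whose simplices are the nonempty sets of vertices that have a common neighbor. (A) If $2s=n$ or $2t=n$, and $\{s,t\}\ne\{n/4,n/2\}$ (equivalently, no connected component of $C_n(s,t)$ is the complete graph $K_4$), then each connected component of (the geometric realization of) $\mathcal N(C_n(s,t))$ is homotopy equivalent to a point or to a wedge sum of finitely many (at least one) circles. (B) If $2s\ne n$, $2t\ne n$ and $2(s+t)=n$, then each connected component of $\mathcal N(C_n(s,t))$ is homotopy equivalent to a point or to the circle $S^1$. -/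

import Mathlib

open scoped ContinuousMap

namespace NbhdComplex

/-- The graph `C_n(s, t)`: its vertices are the residues modulo `n`, and distinct `x`, `y` are
adjacent iff `x - y` or `y - x` is the class of `s` or of `t`, i.e. iff
`x - y ∈ {s, t, n - s, n - t}` modulo `n`. -/
def circ (n s t : ℕ) : SimpleGraph (ZMod n) :=
  SimpleGraph.circulantGraph {(s : ZMod n), (t : ZMod n)}

/-- The neighborhood complex of a graph: its simplices are the nonempty finite sets of vertices
that have a common neighbor. (Thus its vertices are the non-isolated vertices of the graph.) -/
def nbhd {V : Type*} (G : SimpleGraph V) : PreAbstractSimplicialComplex V where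
  faces := {σ | σ.Nonempty ∧ ∃ x, ∀ v ∈ σ, G.Adj x v}
  isRelLowerSet_faces := by
    rintro σ ⟨hσ, x, hx⟩
    exact ⟨hσ, fun τ hτσ hτ => ⟨hτ, x, fun v hv => hx v (hτσ hv)⟩⟩

/-- The underlying space of a simplicial complex on a finite vertex set `V`: the union, over the
simplices `σ`, of the faces of the standard simplex spanned by `σ`, as a subspace of `V → ℝ`. -/
def realization {V : Type*} [Fintype V] (K : PreAbstractSimplicialComplex V) : Set (V → ℝ) :=
  {x | x ∈ stdSimplex ℝ V ∧ ∃ σ ∈ K, ∀ v, x v ≠ 0 → v ∈ σ}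

/-- On the disjoint union `Fin k × Circle` of `k` circles, the relation that identifies all the
base points `(i, 1)` with each other and nothing else. -/
def wedgeSetoid (k : ℕ) : Setoid (Fin k × Circle) where
  r p q := p = q ∨ (p.2 = 1 ∧ q.2 = 1)
  iseqv :=
    { refl := fun _ => Or.inl rfl
      symm := by
        rintro p q (h | ⟨h, h'⟩)
        · exact Or.inl h.symm
        · exact Or.inr ⟨h', h⟩
      trans := by
        rintro p q r (rfl | ⟨h, h'⟩) (rfl | ⟨g, g'⟩)
        · exact Or.inl rfl
        · exact Or.inr ⟨g, g'⟩
        · exact Or.inr ⟨h, h'⟩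
        · exact Or.inr ⟨h, g'⟩ }

/-- The wedge sum of `k` circles (with the quotient topology); used for `1 ≤ k` only. -/
abbrev WedgeOfCircles (k : ℕ) : Type := Quotient (wedgeSetoid k)

end NbhdComplex

/-! In both cases the neighborhoods become short arithmetic progressions. If `2t = n`, then `x - s`,
`x + t`, `x + s` is a progression of difference `d = s + t`, because `2t = 0`. If `2(s + t) = n` and
`m = s + t`, then `x - s` and `x + t` agree modulo `m`, as do `x + s` and `x - t`, so a neighborhood
is the full preimage of `{y, y + 2s}` in `ZMod m`. Thus the simplices are the sets of vertices
lying, under a surjection `c`, over an arc of `k + 1` terms of a coset of `ℤ • d`, with `k = 2` or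
`k = 1`.

Let `r` be the order of `d`. Arcs over different cosets are disjoint, and each coset gives one
component. If `r ≤ k + 1`, one arc covers the coset and the component is a full simplex
(`contractibleSpace_arcSpace`). If `r > 2k`, every arc spans an angle below `π`: barycenters of
vertices placed on the circle project radially to the circle, and a partition of unity by tent
functions gives a homotopy inverse (`nonempty_arcSpace_homotopyEquiv_circle`). The only order left
over is `r = 4` for `k = 2`, where a component would be the boundary of a tetrahedron; this is the
excluded `K₄` case. -/

namespace NbhdComplex

/-! ### Straight-line homotopies, in a subset of a vector space and on the circle. -/

section Homotopy

/-- Two maps into a subset of a real topological vector space are homotopic when the segments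
joining their values stay in the subset. -/
theorem homotopic_of_segment_subset {X E : Type*} [TopologicalSpace X] [AddCommGroup E] [Module ℝ E]
    [TopologicalSpace E] [IsTopologicalAddGroup E] [ContinuousSMul ℝ E] {S : Set E} (f g : C(X, S))
    (h : ∀ x, segment ℝ (f x : E) (g x) ⊆ S) : f.Homotopic g := by
  refine ⟨⟨⟨fun q => ⟨(1 - (q.1 : ℝ)) • (f q.2 : E) + (q.1 : ℝ) • (g q.2 : E),
    h q.2 ⟨1 - q.1, q.1, sub_nonneg.2 q.1.2.2, q.1.2.1, by ring, rfl⟩⟩, ?_⟩, ?_, ?_⟩⟩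
  · fun_prop
  · intro x
    ext
    simp
  · intro x
    ext
    simp

/-- Radial projection of a nonvanishing complex function to the circle. -/
noncomputable def radial {X : Type*} [TopologicalSpace X] (f : C(X, ℂ)) (hf : ∀ x, f x ≠ 0) :
    C(X, Circle) where
  toFun x := ⟨f x / ‖f x‖, by
    have := norm_ne_zero_iff.2 (hf x)
    simp [Submonoid.unitSphere, this]⟩
  continuous_toFun := by
    refine Continuous.subtype_mk (Continuous.div (by fun_prop) (by fun_prop) fun x => ?_) _
    exact_mod_cast norm_ne_zero_iff.2 (hf x)

/-- Maps to the circle that are nowhere antipodal are homotopic. -/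
theorem homotopic_of_ne_neg {X : Type*} [TopologicalSpace X] (f g : C(X, Circle))
    (h : ∀ x, (f x : ℂ) ≠ -(g x : ℂ)) : f.Homotopic g := by
  let H : C(unitInterval × X, ℂ) :=
    ⟨fun q => (1 - (q.1 : ℝ) : ℂ) * (f q.2 : ℂ) + (q.1 : ℝ) * (g q.2 : ℂ), by fun_prop⟩
  have hH : ∀ q, H q ≠ 0 := by
    rintro ⟨t, x⟩ h0
    have h1 : (1 - (t : ℝ) : ℂ) * (f x : ℂ) = -((t : ℝ) * (g x : ℂ)) := eq_neg_of_add_eq_zero_left h0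
    have h2 := congrArg norm h1
    have h3 : ‖(1 - (t : ℝ) : ℂ)‖ = 1 - t := by
      rw [← Complex.ofReal_one, ← Complex.ofReal_sub, Complex.norm_real, Real.norm_eq_abs,
        abs_of_nonneg (sub_nonneg.2 t.2.2)]
    rw [norm_neg, norm_mul, norm_mul, h3, Circle.norm_coe, Circle.norm_coe, Complex.norm_real,
      Real.norm_eq_abs, abs_of_nonneg t.2.1] at h2
    have h4 : (t : ℝ) = 1 / 2 := by linarith
    rw [h4] at h1
    apply h x
    push_cast at h1
    linear_combination 2 * h1
  refine ⟨⟨radial H hH, fun x => ?_, fun x => ?_⟩⟩ <;>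
  · apply Circle.ext
    change H _ / ‖H _‖ = _
    simp [H, Circle.norm_coe]

/-- Connectedness descends along a homotopy equivalence. -/
theorem preconnectedSpace_of_homotopyEquiv {X Y : Type*} [TopologicalSpace X] [TopologicalSpace Y]
    [PathConnectedSpace Y] (e : X ≃ₕ Y) : PreconnectedSpace X := by
  obtain ⟨H⟩ := e.left_inv
  have key : ∀ x, Joined (e.invFun (e.toFun x)) x := fun x => ⟨H.evalAt x⟩
  have : ∀ x y : X, Joined x y := fun x y =>
    (key x).symm.trans (((PathConnectedSpace.joined (e.toFun x) (e.toFun y)).map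
      e.invFun.continuous).trans (key y))
  rcases isEmpty_or_nonempty X with hX | hX
  · infer_instance
  · have : PathConnectedSpace X := ⟨hX, this⟩
    infer_instance

end Homotopy

/-! ### The wedge of a single circle. -/

section Wedge

/-- A wedge of one circle is a circle. -/
def wedgeOneHomeomorph : WedgeOfCircles 1 ≃ₜ Circle where
  toFun := Quotient.lift (fun p : Fin 1 × Circle => p.2) (by
    rintro p q (h | ⟨h, h'⟩)
    · rw [h]
    · rw [h, h'])
  invFun z := Quotient.mk _ (0, z)
  left_inv := by
    rintro ⟨i, z⟩
    obtain rfl := Subsingleton.elim i 0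
    rfl
  right_inv _ := rfl
  continuous_toFun := continuous_snd.quotient_lift _
  continuous_invFun := continuous_quotient_mk'.comp (by fun_prop)

end Wedge

end NbhdComplex

namespace NbhdComplex

/-! ### Complexes of arcs on a cycle: circle or simplex. -/

section Arc

variable {V Q : Type*} [AddCommGroup Q] (c : V → Q) (d y : Q)

/-- The angle between consecutive points of the cycle generated by `d`. -/
noncomputable def stepAngle (d : Q) : ℝ := 2 * Real.pi / addOrderOf d

open Classical in
/-- The angle at which a vertex over the cycle `y + ℤ • d` is placed on the circle. -/
noncomputable def angle (v : V) : ℝ :=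
  if h : ∃ i : ℤ, c v = y + i • d then (h.choose : ℝ) * stepAngle d else 0

/-- The part of the cosine of an angle beyond that of the step angle, at vertices over the cycle. -/
noncomputable def tent (z : ℂ) (v : V) : ℝ :=
  open Classical in
  if ∃ i : ℤ, c v = y + i • d then
    max 0 ((z * Complex.exp ((-angle c d y v : ℝ) * Complex.I)).re - Real.cos (stepAngle d))
  else 0

variable {c d y}

theorem mul_stepAngle (hr : addOrderOf d ≠ 0) : addOrderOf d * stepAngle d = 2 * Real.pi := by
  unfold stepAngle
  field_simp

theorem stepAngle_pos (hr : addOrderOf d ≠ 0) : 0 < stepAngle d := by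
  unfold stepAngle
  have := Real.pi_pos
  have : (0 : ℝ) < addOrderOf d := by exact_mod_cast Nat.pos_of_ne_zero hr
  positivity

theorem mul_stepAngle_lt_pi {k : ℕ} (hk : 2 * k < addOrderOf d) : k * stepAngle d < Real.pi := by
  have hr : addOrderOf d ≠ 0 := by omega
  have h1 := mul_stepAngle hr
  have h2 : (2 * k : ℝ) < addOrderOf d := by exact_mod_cast hk
  have h3 := stepAngle_pos hr
  nlinarith

/-- The index chosen in `angle` is determined only modulo the order of `d`, and that many steps make
a full turn; so any index may be used inside `cos` and `sin`. -/
theorem exists_angle_eq (hr : addOrderOf d ≠ 0) {v : V} {i : ℤ} (h : c v = y + i • d) :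
    ∃ m : ℤ, angle c d y v = i * stepAngle d + m * (2 * Real.pi) := by
  have h' : ∃ i : ℤ, c v = y + i • d := ⟨i, h⟩
  have h2 : h'.choose • d = i • d := add_left_cancel (h'.choose_spec.symm.trans h)
  obtain ⟨m, hm⟩ := (zsmul_eq_zsmul_iff_modEq.1 h2.symm).dvd
  refine ⟨m, ?_⟩
  rw [angle, dif_pos h', ← mul_stepAngle hr]
  have : (h'.choose : ℝ) - i = addOrderOf d * m := by exact_mod_cast hm
  linear_combination stepAngle d * this

theorem cos_angle_sub (hr : addOrderOf d ≠ 0) {v : V} {i : ℤ} (h : c v = y + i • d) (β : ℝ) :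
    Real.cos (angle c d y v - β) = Real.cos (i * stepAngle d - β) := by
  obtain ⟨m, hm⟩ := exists_angle_eq hr h
  rw [hm, add_sub_right_comm, Real.cos_add_int_mul_two_pi]

theorem sin_angle_sub (hr : addOrderOf d ≠ 0) {v : V} {i : ℤ} (h : c v = y + i • d) (β : ℝ) :
    Real.sin (angle c d y v - β) = Real.sin (i * stepAngle d - β) := by
  obtain ⟨m, hm⟩ := exists_angle_eq hr h
  rw [hm, add_sub_right_comm, Real.sin_add_int_mul_two_pi]

theorem exp_mul_exp (a b : ℝ) : Complex.exp (a * Complex.I) * Complex.exp ((-b : ℝ) * Complex.I) =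
    Complex.exp ((a - b : ℝ) * Complex.I) := by
  rw [← Complex.exp_add]
  push_cast
  ring_nf

theorem tent_nonneg (z : ℂ) (v : V) : 0 ≤ tent c d y z v := by
  unfold tent
  split_ifs
  · exact le_max_left _ _
  · exact le_rfl

theorem tent_exp {v : V} (hr : addOrderOf d ≠ 0) {i : ℤ} (h : c v = y + i • d) (φ : ℝ) :
    tent c d y (Complex.exp (φ * Complex.I)) v =
      max 0 (Real.cos (φ - i * stepAngle d) - Real.cos (stepAngle d)) := by
  rw [tent, if_pos ⟨i, h⟩, exp_mul_exp, Complex.exp_ofReal_mul_I_re, ← Real.cos_neg, neg_sub,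
    cos_angle_sub hr h, ← Real.cos_neg, neg_sub]

/-- A tent vanishes at distance at least one step from its vertex. A vertex of the cycle outside the
arc from `i` to `i + k` is at least one step from `φ` in both directions. -/
theorem exists_of_tent_ne_zero (hr : addOrderOf d ≠ 0) {k : ℕ} {φ : ℝ} {i : ℤ}
    (h1 : i * stepAngle d ≤ φ) (h2 : φ ≤ (i + k) * stepAngle d) {v : V}
    (hv : tent c d y (Complex.exp (φ * Complex.I)) v ≠ 0) :
    ∃ j : ℕ, j ≤ k ∧ c v = y + (i + j : ℤ) • d := by
  by_cases h : ∃ a : ℤ, c v = y + a • d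
  swap
  · simp [tent, h] at hv
  obtain ⟨a, ha⟩ := h
  have hr' : (0 : ℤ) < addOrderOf d := by exact_mod_cast Nat.pos_of_ne_zero hr
  obtain ⟨j, hj⟩ := Int.eq_ofNat_of_zero_le (Int.emod_nonneg (a - i) hr'.ne')
  have hjr : (j : ℤ) < addOrderOf d := by
    rw [← hj]
    exact Int.emod_lt_of_pos _ hr'
  have hcv : c v = y + (i + j : ℤ) • d := by
    rw [ha, ← hj]
    congr 1
    rw [zsmul_eq_zsmul_iff_modEq]
    have : i + (a - i) % (addOrderOf d : ℤ) ≡ i + (a - i) [ZMOD addOrderOf d] :=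
      (Int.mod_modEq _ _).add_left i
    rw [add_sub_cancel] at this
    exact this.symm
  refine ⟨j, ?_, hcv⟩
  by_contra! hlt
  apply hv
  rw [tent_exp hr hcv, max_eq_left]
  have hs := stepAngle_pos hr
  have h3 := mul_stepAngle hr
  have hkj : (k : ℝ) + 1 ≤ j := by exact_mod_cast hlt
  have hjr' : (j : ℝ) + 1 ≤ addOrderOf d := by exact_mod_cast hjr
  -- The forward angle from `φ` to the vertex: `j ≥ k + 1` bounds it below by one step, and `j ≤
  -- addOrderOf d - 1` bounds it above by a full turn less one step.
  set δ := (j + i) * stepAngle d - φ with hδ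
  have hδ1 : stepAngle d ≤ δ := by nlinarith
  have hδ2 : δ ≤ 2 * Real.pi - stepAngle d := by nlinarith
  have h4 : Real.cos (φ - ((i + j : ℤ) : ℝ) * stepAngle d) = Real.cos δ := by
    rw [← Real.cos_neg]
    congr 1
    push_cast
    ring
  rw [h4, sub_nonpos]
  rcases le_total δ Real.pi with h5 | h5
  · exact Real.cos_le_cos_of_nonneg_of_le_pi hs.le h5 hδ1
  · rw [← Real.cos_two_pi_sub δ]
    exact Real.cos_le_cos_of_nonneg_of_le_pi hs.le (by linarith) (by linarith)

variable [Fintype V]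

variable (c d y) in
/-- The points of the standard simplex whose support is carried by an arc
`y + i • d, …, y + (i + k) • d` of the cycle `y + ℤ • d`. -/
def arcSpace (k : ℕ) : Set (V → ℝ) :=
  {p | p ∈ stdSimplex ℝ V ∧ ∃ i : ℤ, ∀ v, p v ≠ 0 → ∃ j : ℕ, j ≤ k ∧ c v = y + (i + j : ℤ) • d}

variable (c d y) in
/-- The barycenter of a point of the simplex, with the vertices placed on the circle. -/
noncomputable def barycenter (p : V → ℝ) : ℂ :=
  ∑ v, (p v : ℂ) * Complex.exp (angle c d y v * Complex.I)

theorem continuous_barycenter : Continuous (barycenter c d y) := by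
  unfold barycenter
  fun_prop

theorem re_barycenter_mul (p : V → ℝ) (β : ℝ) :
    (barycenter c d y p * Complex.exp ((-β : ℝ) * Complex.I)).re =
      ∑ v, p v * Real.cos (angle c d y v - β) := by
  simp only [barycenter, Finset.sum_mul, mul_assoc, exp_mul_exp, Complex.re_sum,
    Complex.re_ofReal_mul, Complex.exp_ofReal_mul_I_re]

theorem im_barycenter_mul (p : V → ℝ) (β : ℝ) :
    (barycenter c d y p * Complex.exp ((-β : ℝ) * Complex.I)).im =
      ∑ v, p v * Real.sin (angle c d y v - β) := by
  simp only [barycenter, Finset.sum_mul, mul_assoc, exp_mul_exp, Complex.im_sum,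
    Complex.im_ofReal_mul, Complex.exp_ofReal_mul_I_im]

/-- The arc is shorter than a half-turn, so it lies in the open half-plane centred at its midpoint
`i + k / 2`, and a convex combination stays there. -/
theorem barycenter_ne_zero {k : ℕ} (hk : 2 * k < addOrderOf d) {p : V → ℝ}
    (hp : p ∈ stdSimplex ℝ V) {i : ℤ}
    (hi : ∀ v, p v ≠ 0 → ∃ j : ℕ, j ≤ k ∧ c v = y + (i + j : ℤ) • d) :
    barycenter c d y p ≠ 0 := by
  intro h0
  have hr : addOrderOf d ≠ 0 := by omega
  have hs := stepAngle_pos hr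
  have hpi := mul_stepAngle_lt_pi hk
  have h1 := re_barycenter_mul (c := c) (d := d) (y := y) p ((i + k / 2) * stepAngle d)
  rw [h0, zero_mul, Complex.zero_re] at h1
  have hpos : ∀ v, p v ≠ 0 →
      0 < p v * Real.cos (angle c d y v - (i + k / 2) * stepAngle d) := by
    intro v hv
    obtain ⟨j, hj, hjv⟩ := hi v hv
    have hj' : (j : ℝ) ≤ k := by exact_mod_cast hj
    have hj0 : (0 : ℝ) ≤ j := by positivity
    refine mul_pos ((hp.1 v).lt_of_ne' hv) ?_
    rw [cos_angle_sub hr hjv]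
    push_cast
    apply Real.cos_pos_of_mem_Ioo
    constructor <;> nlinarith
  have hz : ∀ v, p v = 0 := by
    intro v
    by_contra hv
    refine (Finset.sum_pos' (fun w _ => ?_) ⟨v, Finset.mem_univ v, hpos v hv⟩).ne h1
    by_cases hw : p w = 0
    · simp [hw]
    · exact (hpos w hw).le
  have := hp.2
  simp [hz] at this

/-- The barycenter lies in the convex cone over the arc; the two bounds on `φ` are the two
half-planes through the ends of the arc. -/
theorem exists_barycenter_eq {k : ℕ} (hk1 : 1 ≤ k) (hk : 2 * k < addOrderOf d) {p : V → ℝ}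
    (hp : p ∈ stdSimplex ℝ V) {i : ℤ}
    (hi : ∀ v, p v ≠ 0 → ∃ j : ℕ, j ≤ k ∧ c v = y + (i + j : ℤ) • d) :
    ∃ φ : ℝ, i * stepAngle d ≤ φ ∧ φ ≤ (i + k) * stepAngle d ∧
      barycenter c d y p = ‖barycenter c d y p‖ * Complex.exp (φ * Complex.I) := by
  have hr : addOrderOf d ≠ 0 := by omega
  have hs := stepAngle_pos hr
  have hpi := mul_stepAngle_lt_pi hk
  have hne := barycenter_ne_zero hk hp hi
  set P := barycenter c d y p with hP
  set w := P * Complex.exp ((-(i * stepAngle d) : ℝ) * Complex.I) with hw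
  have hwP : P = w * Complex.exp ((i * stepAngle d : ℝ) * Complex.I) := by
    rw [hw, mul_assoc, ← Complex.exp_add]
    push_cast
    ring_nf
    simp
  have hnorm : ‖w‖ = ‖P‖ := by
    rw [hw, norm_mul, Complex.norm_exp_ofReal_mul_I, mul_one]
  have hwa : (‖P‖ : ℂ) * Complex.exp (w.arg * Complex.I) = w := by
    rw [← hnorm, Complex.norm_mul_exp_arg_mul_I]
  have him : 0 ≤ w.im := by
    rw [hw, hP, im_barycenter_mul]
    refine Finset.sum_nonneg fun v _ => ?_
    by_cases hv : p v = 0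
    · simp [hv]
    obtain ⟨j, hj, hjv⟩ := hi v hv
    have hj' : (j : ℝ) ≤ k := by exact_mod_cast hj
    have hj0 : (0 : ℝ) ≤ j := by positivity
    refine mul_nonneg (hp.1 v) ?_
    rw [sin_angle_sub hr hjv]
    push_cast
    apply Real.sin_nonneg_of_nonneg_of_le_pi <;> nlinarith
  have harg := Complex.arg_nonneg_iff.2 him
  refine ⟨i * stepAngle d + w.arg, by linarith, ?_, ?_⟩
  · by_contra! hlt
    have h1 := im_barycenter_mul (c := c) (d := d) (y := y) p ((i + k) * stepAngle d)
    have h2 : ∑ v, p v * Real.sin (angle c d y v - (i + k) * stepAngle d) ≤ 0 := by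
      refine Finset.sum_nonpos fun v _ => ?_
      by_cases hv : p v = 0
      · simp [hv]
      obtain ⟨j, hj, hjv⟩ := hi v hv
      have hj' : (j : ℝ) ≤ k := by exact_mod_cast hj
      have hj0 : (0 : ℝ) ≤ j := by positivity
      refine mul_nonpos_of_nonneg_of_nonpos (hp.1 v) ?_
      rw [sin_angle_sub hr hjv]
      push_cast
      apply Real.sin_nonpos_of_nonpos_of_neg_pi_le <;> nlinarith
    have h3 : P * Complex.exp ((-((i + k) * stepAngle d) : ℝ) * Complex.I) =
        (‖P‖ : ℂ) * Complex.exp ((w.arg - k * stepAngle d : ℝ) * Complex.I) := by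
      conv_lhs => rw [hwP, ← hwa]
      rw [mul_assoc, mul_assoc, ← Complex.exp_add, ← Complex.exp_add]
      push_cast
      ring_nf
    -- Since `w.arg` may equal `π`, a positive arc length is what makes the sine below strictly
    -- positive.
    have hk0 : 0 < k * stepAngle d := mul_pos (by exact_mod_cast hk1) hs
    have harg' := Complex.arg_le_pi w
    rw [← hP, h3, Complex.im_ofReal_mul, Complex.exp_ofReal_mul_I_im] at h1
    have h4 : 0 < Real.sin (w.arg - k * stepAngle d) :=
      Real.sin_pos_of_pos_of_lt_pi (by linarith) (by linarith)
    have h5 := mul_pos (norm_pos_iff.2 hne) h4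
    linarith
  · conv_lhs => rw [hwP, ← hwa]
    rw [mul_assoc, ← Complex.exp_add]
    push_cast
    ring_nf

theorem exists_exp_eq (hr : addOrderOf d ≠ 0) (z : Circle) :
    ∃ (φ : ℝ) (i : ℤ), i * stepAngle d ≤ φ ∧ φ < (i + 1) * stepAngle d ∧
      (z : ℂ) = Complex.exp (φ * Complex.I) := by
  have hs := stepAngle_pos hr
  refine ⟨(z : ℂ).arg, ⌊(z : ℂ).arg / stepAngle d⌋, ?_, ?_, ?_⟩
  · exact (le_div_iff₀ hs).1 (Int.floor_le _)
  · exact (div_lt_iff₀ hs).1 (Int.lt_floor_add_one _)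
  · conv_lhs => rw [← Complex.norm_mul_exp_arg_mul_I (z : ℂ)]
    simp [Circle.norm_coe]

/-- Every point of the circle is less than one step past some vertex, and a step is at most `π`,
where cosine is decreasing. -/
theorem sum_tent_pos (hc : Function.Surjective c) (hr : 2 ≤ addOrderOf d) (z : Circle) :
    0 < ∑ v, tent c d y z v := by
  obtain ⟨φ, i, h1, h2, hz⟩ := exists_exp_eq (d := d) (by omega) z
  obtain ⟨v, hv⟩ := hc (y + i • d)
  refine Finset.sum_pos' (fun w _ => tent_nonneg _ _) ⟨v, Finset.mem_univ v, ?_⟩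
  rw [hz, tent_exp (by omega) hv]
  refine lt_max_of_lt_right (sub_pos.2 ?_)
  have h3 := mul_stepAngle (d := d) (by omega)
  have h4 : (2 : ℝ) ≤ addOrderOf d := by exact_mod_cast hr
  have h5 := stepAngle_pos (d := d) (by omega)
  exact Real.cos_lt_cos_of_nonneg_of_le_pi (by linarith) (by nlinarith) (by linarith)

/-- The partition of unity of the circle given by the tent functions. -/
noncomputable def tentPoint (c : V → Q) (d y : Q) (z : Circle) (v : V) : ℝ :=
  tent c d y z v / ∑ w, tent c d y z w

theorem continuous_tentPoint (hc : Function.Surjective c) (hr : 2 ≤ addOrderOf d) :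
    Continuous (tentPoint c d y) := by
  have h : ∀ v, Continuous fun z : Circle => tent c d y z v := by
    intro v
    unfold tent
    split_ifs <;> fun_prop
  refine continuous_pi fun v => (h v).div (continuous_finsetSum _ fun w _ => h w) fun z => ?_
  exact (sum_tent_pos hc hr z).ne'

theorem tentPoint_mem_stdSimplex (hc : Function.Surjective c) (hr : 2 ≤ addOrderOf d) (z : Circle) :
    tentPoint c d y z ∈ stdSimplex ℝ V := by
  have h := sum_tent_pos (y := y) hc hr z
  refine ⟨fun v => div_nonneg (tent_nonneg _ _) h.le, ?_⟩
  simp only [tentPoint]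
  rw [← Finset.sum_div, div_self h.ne']

theorem tent_ne_zero_of_tentPoint_ne_zero {z : Circle} {v : V} (h : tentPoint c d y z v ≠ 0) :
    tent c d y z v ≠ 0 := fun h0 => h (by rw [tentPoint, h0, zero_div])

theorem tentPoint_mem_arcSpace {k : ℕ} (hk : 1 ≤ k) (hc : Function.Surjective c)
    (hr : 2 ≤ addOrderOf d) (z : Circle) : tentPoint c d y z ∈ arcSpace c d y k := by
  refine ⟨tentPoint_mem_stdSimplex hc hr z, ?_⟩
  obtain ⟨φ, i, h1, h2, hz⟩ := exists_exp_eq (d := d) (by omega) z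
  refine ⟨i, fun v hv => ?_⟩
  have := tent_ne_zero_of_tentPoint_ne_zero hv
  rw [hz] at this
  obtain ⟨j, hj, hjv⟩ := exists_of_tent_ne_zero (k := 1) (by omega) h1 (by push_cast; linarith) this
  exact ⟨j, hj.trans hk, hjv⟩

/-- A cycle of arcs that are short with respect to its length is a circle. -/
theorem nonempty_arcSpace_homotopyEquiv_circle {k : ℕ} (hk : 1 ≤ k) (hkd : 2 * k < addOrderOf d)
    (hc : Function.Surjective c) : Nonempty (arcSpace c d y k ≃ₕ Circle) := by
  have hr : 2 ≤ addOrderOf d := by omega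
  have hne : ∀ p : arcSpace c d y k, barycenter c d y p ≠ 0 := fun p =>
    barycenter_ne_zero hkd p.2.1 p.2.2.choose_spec
  let b : C(arcSpace c d y k, ℂ) :=
    ⟨fun p => barycenter c d y p, continuous_barycenter.comp continuous_subtype_val⟩
  let f : C(arcSpace c d y k, Circle) := radial b hne
  let g : C(Circle, arcSpace c d y k) :=
    ⟨fun z => ⟨tentPoint c d y z, tentPoint_mem_arcSpace hk hc hr z⟩,
      (continuous_tentPoint hc hr).subtype_mk _⟩
  have hf : ∀ (p : arcSpace c d y k) (φ : ℝ), barycenter c d y p =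
      ‖barycenter c d y p‖ * Complex.exp (φ * Complex.I) →
      (f p : ℂ) = Complex.exp (φ * Complex.I) := by
    intro p φ h
    have h0 : (‖barycenter c d y p‖ : ℂ) ≠ 0 := by exact_mod_cast norm_ne_zero_iff.2 (hne p)
    change barycenter c d y p / (‖barycenter c d y p‖ : ℂ) = _
    rw [div_eq_iff h0, mul_comm]
    exact h
  refine ⟨⟨f, g, homotopic_of_segment_subset _ _ fun p => ?_, homotopic_of_ne_neg _ _ fun z => ?_⟩⟩
  · obtain ⟨hp, i, hi⟩ := p.2
    -- The projection of `p` falls within the arc carrying `p`, so the tents active there sit on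
    -- that same arc, and the whole segment is carried by it.
    obtain ⟨φ, h1, h2, h3⟩ := exists_barycenter_eq hk hkd hp hi
    intro q hq
    refine ⟨convex_stdSimplex ℝ V |>.segment_subset (g (f p)).2.1 hp hq, i, fun v hv => ?_⟩
    by_cases hpv : (p : V → ℝ) v = 0
    · have hgv : tentPoint c d y (f p) v ≠ 0 := by
        intro h0
        obtain ⟨a, b, _, _, _, rfl⟩ := hq
        apply hv
        change a * tentPoint c d y (f p) v + b * (p : V → ℝ) v = 0
        simp [hpv, h0]
      have := tent_ne_zero_of_tentPoint_ne_zero hgv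
      rw [hf p φ h3] at this
      exact exists_of_tent_ne_zero (by omega) h1 h2 this
    · exact hi v hpv
  · obtain ⟨φ, i, h1, h2, hz⟩ := exists_exp_eq (d := d) (by omega) z
    have hi : ∀ v, tentPoint c d y z v ≠ 0 → ∃ j : ℕ, j ≤ 1 ∧ c v = y + (i + j : ℤ) • d := by
      intro v hv
      have := tent_ne_zero_of_tentPoint_ne_zero hv
      rw [hz] at this
      exact exists_of_tent_ne_zero (by omega) h1 (by push_cast; linarith) this
    have hd : 2 * 1 < addOrderOf d := by omega
    -- Both `φ` and `ψ` lie between vertices `i` and `i + 1`, hence differ by at most one step,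
    -- which is less than `π`.
    obtain ⟨ψ, h3, h4, h5⟩ := exists_barycenter_eq le_rfl hd (tentPoint_mem_stdSimplex hc hr z) hi
    have h6 : (f (g z) : ℂ) = Complex.exp (ψ * Complex.I) := hf (g z) ψ h5
    change (f (g z) : ℂ) ≠ -(z : ℂ)
    rw [h6, hz]
    intro h
    have hpi := mul_stepAngle_lt_pi hd
    have h7 := congrArg (fun w => (w * Complex.exp ((-φ : ℝ) * Complex.I)).re) h
    simp only [neg_mul, exp_mul_exp, Complex.neg_re, Complex.exp_ofReal_mul_I_re, sub_self,
      Real.cos_zero] at h7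
    push_cast at hpi h4
    have h8 : -1 < Real.cos (ψ - φ) := by
      rw [← Real.cos_abs, ← Real.cos_pi]
      exact Real.cos_lt_cos_of_nonneg_of_le_pi (abs_nonneg _) le_rfl
        (abs_lt.2 ⟨by linarith, by linarith⟩)
    linarith

theorem mem_arcSpace_iff_of_le {k : ℕ} (hr : addOrderOf d ≠ 0) (hkd : addOrderOf d ≤ k + 1)
    {p : V → ℝ} : p ∈ arcSpace c d y k ↔
      p ∈ stdSimplex ℝ V ∧ ∀ v, p v ≠ 0 → ∃ i : ℤ, c v = y + i • d := by
  refine and_congr_right fun _ => ⟨fun ⟨i, hi⟩ v hv => ?_, fun h => ⟨0, fun v hv => ?_⟩⟩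
  · obtain ⟨j, -, hj⟩ := hi v hv
    exact ⟨_, hj⟩
  · obtain ⟨i, hi⟩ := h v hv
    have hr' : (0 : ℤ) < addOrderOf d := by exact_mod_cast Nat.pos_of_ne_zero hr
    obtain ⟨j, hj⟩ := Int.eq_ofNat_of_zero_le (Int.emod_nonneg i hr'.ne')
    have hjr := Int.emod_lt_of_pos i hr'
    refine ⟨j, by omega, ?_⟩
    rw [hi, zero_add, ← hj, ← mod_addOrderOf_zsmul]

/-- A cycle covered by a single arc spans a simplex. -/
theorem contractibleSpace_arcSpace {k : ℕ} (hr : addOrderOf d ≠ 0) (hkd : addOrderOf d ≤ k + 1)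
    (hc : Function.Surjective c) : ContractibleSpace (arcSpace c d y k) := by
  classical
  refine Convex.contractibleSpace (fun p hp q hq a b ha hb hab => ?_) ?_
  · rw [mem_arcSpace_iff_of_le hr hkd] at hp hq ⊢
    refine ⟨convex_stdSimplex ℝ V hp.1 hq.1 ha hb hab, fun v hv => ?_⟩
    by_cases hpv : p v = 0
    · refine hq.2 v fun hqv => hv ?_
      simp [hpv, hqv]
    · exact hp.2 v hpv
  · obtain ⟨v, hv⟩ := hc y
    refine ⟨Pi.single v 1, (mem_arcSpace_iff_of_le hr hkd).2
      ⟨single_mem_stdSimplex ℝ v, fun w hw => ⟨0, ?_⟩⟩⟩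
    obtain rfl : w = v := by
      by_contra hne
      exact hw (Pi.single_eq_of_ne hne 1)
    simp [hv]

end Arc

/-! ### Connected components of the realization. -/

section Component

variable {V Q : Type*} [Fintype V] [AddCommGroup Q] {c : V → Q} {d : Q} {k : ℕ}
  {K : PreAbstractSimplicialComplex V}

theorem arcSpace_subset_realization
    (hK : ∀ σ, σ ∈ K ↔ σ.Nonempty ∧ ∃ y, ∀ v ∈ σ, ∃ j : ℕ, j ≤ k ∧ c v = y + j • d) (y : Q) :
    arcSpace c d y k ⊆ realization K := by
  classical
  rintro p ⟨hp, i, hi⟩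
  refine ⟨hp, Finset.univ.filter fun v => p v ≠ 0, (hK _).2 ⟨?_, y + i • d, fun v hv => ?_⟩, ?_⟩
  · by_contra h
    have h0 : ∀ v, p v = 0 := by simpa [Finset.filter_eq_empty_iff] using h
    have := hp.2
    simp [h0] at this
  · obtain ⟨j, hj, hjv⟩ := hi v (by simpa using hv)
    exact ⟨j, hj, by rw [hjv, add_smul, add_assoc, natCast_zsmul]⟩
  · simp

open Classical in
/-- The total weight over a cycle is `0` or `1`, the latter exactly on the points over the cycle. -/
theorem mem_arcSpace_iff_of_mem_realization
    (hK : ∀ σ, σ ∈ K ↔ σ.Nonempty ∧ ∃ y, ∀ v ∈ σ, ∃ j : ℕ, j ≤ k ∧ c v = y + j • d) (y : Q)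
    {p : V → ℝ} (hp : p ∈ realization K) :
    (p ∈ arcSpace c d y k ∧ ∑ v, (if ∃ i : ℤ, c v = y + i • d then p v else 0) = 1) ∨
    (p ∉ arcSpace c d y k ∧ ∑ v, (if ∃ i : ℤ, c v = y + i • d then p v else 0) = 0) := by
  obtain ⟨hp, σ, hσ, hpσ⟩ := hp
  obtain ⟨hne, y', hy'⟩ := (hK σ).1 hσ
  by_cases h : ∃ i : ℤ, y' = y + i • d
  · obtain ⟨i, hi⟩ := h
    have hi' : ∀ v, p v ≠ 0 → ∃ j : ℕ, j ≤ k ∧ c v = y + (i + j : ℤ) • d := by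
      intro v hv
      obtain ⟨j, hj, hjv⟩ := hy' v (hpσ v hv)
      exact ⟨j, hj, by rw [hjv, hi, add_smul, add_assoc, natCast_zsmul]⟩
    refine Or.inl ⟨⟨hp, i, hi'⟩, ?_⟩
    rw [← hp.2]
    refine Finset.sum_congr rfl fun v _ => ?_
    split_ifs with hv
    · rfl
    · by_contra h0
      obtain ⟨j, -, hj⟩ := hi' v (Ne.symm h0)
      exact hv ⟨_, hj⟩
  · have hout : ∀ v, p v ≠ 0 → ¬ ∃ i : ℤ, c v = y + i • d := by
      rintro v hv ⟨i, hi⟩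
      obtain ⟨j, -, hj⟩ := hy' v (hpσ v hv)
      refine h ⟨i - j, ?_⟩
      rw [sub_smul, natCast_zsmul, ← add_sub_assoc, ← hi, hj, add_sub_cancel_right]
    refine Or.inr ⟨?_, Finset.sum_eq_zero fun v _ => ?_⟩
    · rintro ⟨-, i, hi⟩
      have h0 : ∀ v, p v = 0 := by
        intro v
        by_contra hv
        obtain ⟨j, -, hj⟩ := hi v hv
        exact hout v hv ⟨_, hj⟩
      have := hp.2
      simp [h0] at this
    · split_ifs with hv
      · by_contra h0
        exact hout v h0 hv
      · rfl

/-- The connected components of the realization are the spaces of arcs. -/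
theorem exists_connectedComponent_homeomorph_arcSpace
    (hK : ∀ σ, σ ∈ K ↔ σ.Nonempty ∧ ∃ y, ∀ v ∈ σ, ∃ j : ℕ, j ≤ k ∧ c v = y + j • d)
    (hconn : ∀ y, PreconnectedSpace (arcSpace c d y k)) (x : realization K) :
    ∃ y, Nonempty (connectedComponent x ≃ₜ arcSpace c d y k) := by
  classical
  obtain ⟨hp, σ, hσ, hpσ⟩ := x.2
  obtain ⟨hne, y, hy⟩ := (hK σ).1 hσ
  refine ⟨y, ?_⟩
  have hx : (x : V → ℝ) ∈ arcSpace c d y k := by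
    refine ⟨hp, 0, fun v hv => ?_⟩
    obtain ⟨j, hj, hjv⟩ := hy v (hpσ v hv)
    exact ⟨j, hj, by rw [hjv, zero_add, natCast_zsmul]⟩
  let X : Set (realization K) := Subtype.val ⁻¹' arcSpace c d y k
  have hsub := arcSpace_subset_realization hK y
  -- This continuous weight takes only the values `0` and `1`, so its level sets are clopen.
  let h : realization K → ℝ := fun p =>
    ∑ v, (if ∃ i : ℤ, c v = y + i • d then (p : V → ℝ) v else 0)
  have hcont : Continuous h := by
    refine continuous_finsetSum _ fun v _ => ?_
    split_ifs
    · exact (continuous_apply v).comp continuous_subtype_val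
    · exact continuous_const
  have hmem := fun p : realization K => mem_arcSpace_iff_of_mem_realization hK y p.2
  have hclosed : IsClosed X := by
    have : X = h ⁻¹' {1} := by
      ext p
      rcases hmem p with ⟨h1, h2⟩ | ⟨h1, h2⟩
      · exact iff_of_true h1 h2
      · refine iff_of_false h1 fun h3 => ?_
        exact zero_ne_one (h2.symm.trans h3)
    rw [this]
    exact isClosed_singleton.preimage hcont
  have hopen : IsOpen X := by
    have : X = h ⁻¹' {0}ᶜ := by
      ext p
      rcases hmem p with ⟨h1, h2⟩ | ⟨h1, h2⟩
      · refine iff_of_true h1 fun h3 => ?_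
        exact zero_ne_one (h3.symm.trans h2)
      · exact iff_of_false h1 fun h3 => h3 h2
    rw [this]
    exact isClosed_singleton.isOpen_compl.preimage hcont
  have hpre : IsPreconnected X := by
    rw [← Topology.IsInducing.subtypeVal.isPreconnected_image, Subtype.image_preimage_coe,
      Set.inter_eq_right.2 hsub]
    exact isPreconnected_iff_preconnectedSpace.2 (hconn y)
  have hX : connectedComponent x = X :=
    (IsClopen.connectedComponent_subset ⟨hclosed, hopen⟩ hx).antisymm
      (hpre.subset_connectedComponent hx)
  rw [hX]
  exact ⟨{
    toFun := fun p => ⟨p.1.1, p.2⟩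
    invFun := fun p => ⟨⟨p.1, hsub p.2⟩, p.2⟩
    left_inv := fun _ => rfl
    right_inv := fun _ => rfl
    continuous_toFun := by fun_prop
    continuous_invFun := by fun_prop }⟩

theorem connectedComponent_homotopyEquiv_circle (hk : 1 ≤ k) (hkd : 2 * k < addOrderOf d)
    (hc : Function.Surjective c)
    (hK : ∀ σ, σ ∈ K ↔ σ.Nonempty ∧ ∃ y, ∀ v ∈ σ, ∃ j : ℕ, j ≤ k ∧ c v = y + j • d)
    (x : realization K) : Nonempty (connectedComponent x ≃ₕ Circle) := by
  have hcirc := fun y => nonempty_arcSpace_homotopyEquiv_circle (y := y) hk hkd hc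
  obtain ⟨y, ⟨e⟩⟩ := exists_connectedComponent_homeomorph_arcSpace hK
    (fun y => preconnectedSpace_of_homotopyEquiv (hcirc y).some) x
  exact ⟨e.toHomotopyEquiv.trans (hcirc y).some⟩

theorem connectedComponent_homotopyEquiv_unit (hr : addOrderOf d ≠ 0) (hkd : addOrderOf d ≤ k + 1)
    (hc : Function.Surjective c)
    (hK : ∀ σ, σ ∈ K ↔ σ.Nonempty ∧ ∃ y, ∀ v ∈ σ, ∃ j : ℕ, j ≤ k ∧ c v = y + j • d)
    (x : realization K) : Nonempty (connectedComponent x ≃ₕ Unit) := by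
  have hcontr := fun y => contractibleSpace_arcSpace (y := y) hr hkd hc
  obtain ⟨y, ⟨e⟩⟩ := exists_connectedComponent_homeomorph_arcSpace hK
    (fun y => have := hcontr y; inferInstance) x
  have := hcontr y
  exact ⟨e.toHomotopyEquiv.trans (ContractibleSpace.hequiv _ _).some⟩

end Component

end NbhdComplex

namespace NbhdComplex

/-! ### Neighborhoods in the circulant graphs. -/

section Circulant

theorem circ_comm (n s t : ℕ) : circ n s t = circ n t s := by
  rw [circ, circ, Set.pair_comm]

theorem natCast_ne_zero_of_lt {n a : ℕ} (h0 : 0 < a) (h : a < n) : (a : ZMod n) ≠ 0 := by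
  rw [Ne, ZMod.natCast_eq_zero_iff]
  exact Nat.not_dvd_of_pos_of_lt h0 h

theorem circ_adj {n s t : ℕ} (hs : (s : ZMod n) ≠ 0) (ht : (t : ZMod n) ≠ 0) (x v : ZMod n) :
    (circ n s t).Adj x v ↔ v = x - s ∨ v = x - t ∨ v = x + s ∨ v = x + t := by
  simp only [circ, SimpleGraph.circulantGraph, SimpleGraph.fromRel_adj, Set.mem_insert_iff,
    Set.mem_singleton_iff]
  constructor
  · rintro ⟨-, (h | h) | (h | h)⟩
    · exact Or.inl (by rw [← h]; ring)
    · exact Or.inr (Or.inl (by rw [← h]; ring))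
    · exact Or.inr (Or.inr (Or.inl (by rw [← h]; ring)))
    · exact Or.inr (Or.inr (Or.inr (by rw [← h]; ring)))
  · rintro (rfl | rfl | rfl | rfl) <;> simp [hs, ht, eq_sub_iff_add_eq]

theorem mem_nbhd {V : Type*} {G : SimpleGraph V} {σ : Finset V} :
    σ ∈ nbhd G ↔ σ.Nonempty ∧ ∃ x, ∀ v ∈ σ, G.Adj x v := Iff.rfl

/-- If `2 t = n`, the neighborhoods of `C_n(s, t)` are the sets `{y, y + d, y + 2 d}` for
`d = s + t`. -/
theorem mem_nbhd_circ_of_two_mul_eq {n s t : ℕ} (hs : (s : ZMod n) ≠ 0) (ht : (t : ZMod n) ≠ 0)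
    (h : 2 * t = n) (σ : Finset (ZMod n)) :
    σ ∈ nbhd (circ n s t) ↔ σ.Nonempty ∧
      ∃ y, ∀ v ∈ σ, ∃ j : ℕ, j ≤ 2 ∧ id v = y + j • (s + t : ZMod n) := by
  have h2 : (t : ZMod n) + t = 0 := by
    rw [← two_mul]
    exact_mod_cast (ZMod.natCast_eq_zero_iff _ _).2 (dvd_of_eq h.symm)
  have key : ∀ x v : ZMod n, (circ n s t).Adj x v ↔
      ∃ j : ℕ, j ≤ 2 ∧ id v = x - s + j • (s + t : ZMod n) := by
    intro x v
    rw [circ_adj hs ht]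
    constructor
    · rintro (rfl | rfl | rfl | rfl)
      · exact ⟨0, by norm_num, by simp⟩
      · exact ⟨1, by norm_num, by simp only [id, one_smul]; linear_combination -h2⟩
      · exact ⟨2, by norm_num, by simp only [id, two_smul]; linear_combination -h2⟩
      · exact ⟨1, by norm_num, by simp only [id, one_smul]; ring⟩
    · rintro ⟨j, hj, hv⟩
      interval_cases j
      · exact Or.inl (by simpa using hv)
      · refine Or.inr (Or.inr (Or.inr ?_))
        simp only [id, one_smul] at hv
        linear_combination hv
      · refine Or.inr (Or.inr (Or.inl ?_))
        simp only [id, two_smul] at hv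
        linear_combination hv + h2
  rw [mem_nbhd]
  simp only [key]
  refine and_congr_right fun _ => ⟨fun ⟨x, hx⟩ => ⟨x - s, hx⟩, fun ⟨y, hy⟩ => ⟨y + s, ?_⟩⟩
  simpa using hy

/-- If `n = 2 m` and `s + t = m`, the neighborhoods of `C_n(s, t)` are the preimages of the sets
`{y, y + 2 s}` of residues modulo `m`. -/
theorem mem_nbhd_circ_of_add_eq {m s t : ℕ} (hs : (s : ZMod (2 * m)) ≠ 0)
    (ht : (t : ZMod (2 * m)) ≠ 0) (h : s + t = m) (σ : Finset (ZMod (2 * m))) :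
    σ ∈ nbhd (circ (2 * m) s t) ↔ σ.Nonempty ∧
      ∃ y, ∀ v ∈ σ, ∃ j : ℕ, j ≤ 1 ∧
        ZMod.castHom (dvd_mul_left m 2) (ZMod m) v = y + j • ((2 * s : ℕ) : ZMod m) := by
  set f := ZMod.castHom (dvd_mul_left m 2) (ZMod m) with hf
  have hm : (m : ZMod (2 * m)) + m = 0 := by
    rw [← two_mul]
    exact_mod_cast (ZMod.natCast_self (2 * m))
  have hst : (s : ZMod (2 * m)) + t = m := by exact_mod_cast congrArg Nat.cast h
  -- The kernel of reduction modulo `m` is `{0, m}`: a multiple `m * q` is `0` or `m` according to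
  -- the parity of `q`.
  have hker : ∀ v w : ZMod (2 * m), f v = f w ↔ v = w ∨ v = w + m := by
    intro v w
    constructor
    · intro hvw
      obtain ⟨a, rfl⟩ := ZMod.intCast_surjective v
      obtain ⟨b, rfl⟩ := ZMod.intCast_surjective w
      rw [map_intCast, map_intCast, eq_comm, ZMod.intCast_eq_intCast_iff_dvd_sub] at hvw
      obtain ⟨q, hq⟩ := hvw
      have hq' : (a : ZMod (2 * m)) = b + m * q := by
        have : a = b + m * q := by linarith
        rw [this]
        push_cast
        ring
      rcases Int.even_or_odd' q with ⟨e, rfl | rfl⟩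
      · refine Or.inl ?_
        rw [hq']
        push_cast
        linear_combination (e : ZMod (2 * m)) * hm
      · refine Or.inr ?_
        rw [hq']
        push_cast
        linear_combination (e : ZMod (2 * m)) * hm
    · rintro (rfl | rfl)
      · rfl
      · rw [map_add, map_natCast, ZMod.natCast_self, add_zero]
  have key : ∀ x v : ZMod (2 * m), (circ (2 * m) s t).Adj x v ↔
      ∃ j : ℕ, j ≤ 1 ∧ f v = f (x - s) + j • ((2 * s : ℕ) : ZMod m) := by
    intro x v
    have h1 : f (x - s) + ((2 * s : ℕ) : ZMod m) = f (x + s) := by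
      rw [map_sub, map_add, map_natCast]
      push_cast
      ring
    have : (∃ j : ℕ, j ≤ 1 ∧ f v = f (x - s) + j • ((2 * s : ℕ) : ZMod m)) ↔
        f v = f (x - s) ∨ f v = f (x + s) := by
      rw [← h1]
      constructor
      · rintro ⟨j, hj, hv⟩
        interval_cases j
        · exact Or.inl (by simpa using hv)
        · exact Or.inr (by simpa using hv)
      · rintro (h | h)
        · exact ⟨0, by norm_num, by simpa using h⟩
        · exact ⟨1, by norm_num, by simpa using h⟩
    have ht1 : x - s + (m : ZMod (2 * m)) = x + t := by rw [← hst]; ring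
    have ht2 : x + s + (m : ZMod (2 * m)) = x - t := by linear_combination hm + hst
    rw [this, circ_adj hs ht, hker, hker, ht1, ht2]
    tauto
  rw [mem_nbhd]
  simp only [key]
  refine and_congr_right fun _ => ⟨fun ⟨x, hx⟩ => ⟨_, hx⟩, fun ⟨y, hy⟩ => ?_⟩
  obtain ⟨x, rfl⟩ := ZMod.castHom_surjective (dvd_mul_left m 2) y
  exact ⟨x + s, by simpa only [add_sub_cancel_right] using hy⟩

theorem connectedComponent_nbhd_circ_of_two_mul_eq {n s t : ℕ} [NeZero n] (hs1 : 1 ≤ s)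
    (hs2 : s ≤ n / 2) (hst : s ≠ t) (h : 2 * t = n) (h4 : 4 * s ≠ n)
    (x : realization (nbhd (circ n s t))) :
    Nonempty (connectedComponent x ≃ₕ Unit) ∨ Nonempty (connectedComponent x ≃ₕ Circle) := by
  have hs := natCast_ne_zero_of_lt (n := n) (a := s) (by omega) (by omega)
  have ht := natCast_ne_zero_of_lt (n := n) (a := t) (by omega) (by omega)
  have hK := mem_nbhd_circ_of_two_mul_eq hs ht h
  set d : ZMod n := s + t with hd
  have hd' : d = ((s + t : ℕ) : ZMod n) := by push_cast; rfl
  have hr : addOrderOf d ≠ 0 := (addOrderOf_pos d).ne'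
  have hmul : ∀ r : ℕ, addOrderOf d = r → n ∣ r * (s + t) := by
    rintro r rfl
    have := addOrderOf_nsmul_eq_zero d
    rw [hd', nsmul_eq_mul, ← Nat.cast_mul, ZMod.natCast_eq_zero_iff] at this
    exact hd' ▸ this
  have h1 : addOrderOf d ≠ 4 := by
    intro hr4
    obtain ⟨q, hq⟩ := hmul 4 hr4
    -- From `4(s + t) = 4s + 2n`. As `0 < 4s < 2n` (here `s ≠ t = n / 2`), only `4s = n` could
    -- remain, and `h4` forbids it.
    have : 4 * s = n * (q - 2) := by
      rw [Nat.mul_sub]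
      omega
    have hlt : q - 2 < 2 := by
      by_contra! hge
      have := Nat.mul_le_mul_left n hge
      omega
    interval_cases q - 2 <;> omega
  by_cases h3 : addOrderOf d ≤ 3
  · exact Or.inl (connectedComponent_homotopyEquiv_unit hr h3 Function.surjective_id hK x)
  · exact Or.inr (connectedComponent_homotopyEquiv_circle (by norm_num) (by omega)
      Function.surjective_id hK x)

theorem connectedComponent_nbhd_circ_of_add_eq {n s t : ℕ} [NeZero n] (hs1 : 1 ≤ s) (ht1 : 1 ≤ t)
    (h : 2 * (s + t) = n) (x : realization (nbhd (circ n s t))) :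
    Nonempty (connectedComponent x ≃ₕ Unit) ∨ Nonempty (connectedComponent x ≃ₕ Circle) := by
  obtain ⟨m, hm⟩ : ∃ m, s + t = m := ⟨_, rfl⟩
  rw [hm] at h
  subst h
  have hs := natCast_ne_zero_of_lt (n := 2 * m) (a := s) (by omega) (by omega)
  have ht := natCast_ne_zero_of_lt (n := 2 * m) (a := t) (by omega) (by omega)
  have : NeZero m := ⟨by omega⟩
  have hK := mem_nbhd_circ_of_add_eq hs ht hm
  have hc := ZMod.castHom_surjective (dvd_mul_left m 2)
  have hr := (addOrderOf_pos ((2 * s : ℕ) : ZMod m)).ne'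
  by_cases h2 : addOrderOf ((2 * s : ℕ) : ZMod m) ≤ 2
  · exact Or.inl (connectedComponent_homotopyEquiv_unit hr h2 hc hK x)
  · exact Or.inr (connectedComponent_homotopyEquiv_circle le_rfl (by omega) hc hK x)

end Circulant

end NbhdComplex

theorem theorem3p3 (n : ℕ) [NeZero n] (hn : 5 ≤ n) (s t : ℕ)
    (hs : s ∈ Finset.Icc 1 (n / 2)) (ht : t ∈ Finset.Icc 1 (n / 2)) (hst : s ≠ t) :
    ((2 * s = n ∨ 2 * t = n) → ¬ (2 * s = n ∧ 4 * t = n) → ¬ (2 * t = n ∧ 4 * s = n) →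
      ∀ x : NbhdComplex.realization (NbhdComplex.nbhd (NbhdComplex.circ n s t)),
        Nonempty (connectedComponent x ≃ₕ Unit) ∨
          ∃ k : ℕ, 1 ≤ k ∧ Nonempty (connectedComponent x ≃ₕ NbhdComplex.WedgeOfCircles k)) ∧
    (2 * s ≠ n → 2 * t ≠ n → 2 * (s + t) = n →
      ∀ x : NbhdComplex.realization (NbhdComplex.nbhd (NbhdComplex.circ n s t)),
        Nonempty (connectedComponent x ≃ₕ Unit) ∨
          Nonempty (connectedComponent x ≃ₕ Circle)) := by
  rw [Finset.mem_Icc] at hs ht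
  -- A single circle always suffices for (A), so the wedge is taken with `k = 1`.
  have hwedge : ∀ {X : Type} [TopologicalSpace X],
      Nonempty (X ≃ₕ Unit) ∨ Nonempty (X ≃ₕ Circle) →
      Nonempty (X ≃ₕ Unit) ∨ ∃ k : ℕ, 1 ≤ k ∧ Nonempty (X ≃ₕ NbhdComplex.WedgeOfCircles k) :=
    fun h => h.imp_right fun ⟨e⟩ =>
      ⟨1, le_rfl, ⟨e.trans NbhdComplex.wedgeOneHomeomorph.symm.toHomotopyEquiv⟩⟩
  refine ⟨?_, fun _ _ h x => NbhdComplex.connectedComponent_nbhd_circ_of_add_eq hs.1 ht.1 h x⟩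
  rintro (h | h) h1 h2 x
  · revert x
    rw [NbhdComplex.circ_comm]
    intro x
    exact hwedge (NbhdComplex.connectedComponent_nbhd_circ_of_two_mul_eq ht.1 ht.2 hst.symm h
      (fun h4 => h1 ⟨h, h4⟩) x)
  · exact hwedge (NbhdComplex.connectedComponent_nbhd_circ_of_two_mul_eq hs.1 hs.2 hst h
      (fun h4 => h2 ⟨h, h4⟩) x)
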